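/- Consider first-order formulae with equality over purely relational signatures. The guarded fragment $\mathrm{GF}$ is the smallest set of formulae that contains all atoms (relational atoms and equalities between variables), is closed under boolean connectives, and contains $\forall\bar y\,(\gamma(\bar x,\bar y)\to\psi(\bar x,\bar y))$ and $\exists\bar y\,(\gamma(\bar x,\bar y)\wedge\psi(\bar x,\bar y))$ whenever $\psi$ is in the set and $\gamma$ is an atom (equality allowed) containing all free variables of $\psi$. For a binary relation symbol $R$ and a rational $q\in[0,100]$, the local percentage quantifier has the semantics, over a finite structure $\mathfrak M$, \[\mathfrak M,x/a\models \exists^{=q\%}_{R}\,y\ \varphi(x,y)\iff |\{b : \mathfrak M\models R(a,b)\wedge\varphi(a,b)\}|=\tfrac{q}{100}\cdot|\{b : \mathfrak M\models R(a,b)\}| .\] The logic $\mathrm{GF}_{loc\%}$ is obtained by adding to the formation rules of $\mathrm{GF}$ the rule that $\exists^{=q\%}_{R}\,y\ \varphi(x,y)$ is a formula for every $\varphi\in\mathrm{GF}$ with free variables among the distinct variables $x,y$; $\mathrm{GF}^3_{loc\%}$ is its fragment in which only three variables are used (they may be requantified). Theorem. The finite satisfiability problem for $\mathrm{GF}_{loc\%}$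 (given a sentence, does it have a finite nonempty model?) is undecidable. It remains undecidable for sentences of $\mathrm{GF}^3_{loc\%}$ over signatures whose relation symbols have arity at most three. -/

import Mathlib

namespace PercLogic

open FirstOrder

/-- The relational vocabulary: countably many relation symbols `r : ℕ` of every arity, and no
constant or function symbols.  (Every formula uses only finitely many of the symbols.) -/
abbrev relLang : Language := ⟨fun _ => Empty, fun _ => ℕ⟩

/-- First-order formulae with equality over `relLang`, with variables named by natural numbers,
extended with the local percentage quantifiers.  The formula `perc q r x y φ` is
`∃^{=q%}_r y φ(x, y)`: exactly `q` percent of the `r`-successors `y` of `x` satisfy `φ`. -/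
inductive Formula : Type
  | eq (x y : ℕ) : Formula
  | rel {n : ℕ} (r : ℕ) (v : Fin n → ℕ) : Formula
  | neg (φ : Formula) : Formula
  | and (φ ψ : Formula) : Formula
  | or (φ ψ : Formula) : Formula
  | imp (φ ψ : Formula) : Formula
  | all (x : ℕ) (φ : Formula) : Formula
  | ex (x : ℕ) (φ : Formula) : Formula
  | perc (q : ℚ) (r x y : ℕ) (φ : Formula) : Formula

namespace Formula

/-- The block `∀ y₁ … ∀ yₘ φ`. -/
def allBlock (ys : List ℕ) (φ : Formula) : Formula := ys.foldr all φ

/-- The block `∃ y₁ … ∃ yₘ φ`. -/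
def exBlock (ys : List ℕ) (φ : Formula) : Formula := ys.foldr ex φ

/-- The free variables of a formula. -/
def free : Formula → Finset ℕ
  | eq x y => {x, y}
  | rel _ v => Finset.univ.image v
  | neg φ => φ.free
  | and φ ψ => φ.free ∪ ψ.free
  | or φ ψ => φ.free ∪ ψ.free
  | imp φ ψ => φ.free ∪ ψ.free
  | all x φ => φ.free.erase x
  | ex x φ => φ.free.erase x
  | perc _ _ x y φ => insert x (φ.free.erase y)

/-- All variables that occur in a formula, free or bound. -/
def vars : Formula → Finset ℕ
  | eq x y => {x, y}
  | rel _ v => Finset.univ.image v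
  | neg φ => φ.vars
  | and φ ψ => φ.vars ∪ ψ.vars
  | or φ ψ => φ.vars ∪ ψ.vars
  | imp φ ψ => φ.vars ∪ ψ.vars
  | all x φ => insert x φ.vars
  | ex x φ => insert x φ.vars
  | perc _ _ x y φ => insert x (insert y φ.vars)

/-- All relation symbols in the formula have arity at most `m`. -/
def ArityLE (m : ℕ) : Formula → Prop
  | eq _ _ => True
  | rel (n := n) _ _ => n ≤ m
  | neg φ => φ.ArityLE m
  | and φ ψ => φ.ArityLE m ∧ ψ.ArityLE m
  | or φ ψ => φ.ArityLE m ∧ ψ.ArityLE m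
  | imp φ ψ => φ.ArityLE m ∧ ψ.ArityLE m
  | all _ φ => φ.ArityLE m
  | ex _ φ => φ.ArityLE m
  | perc _ _ _ _ φ => 2 ≤ m ∧ φ.ArityLE m

/-- Satisfaction of a formula in a structure under an assignment of the variables
(the percentage quantifier is meant for finite structures). -/
def Sat {M : Type} [relLang.Structure M] : Formula → (ℕ → M) → Prop
  | eq x y, s => s x = s y
  | rel (n := n) r v, s => Language.Structure.RelMap (L := relLang) (n := n) r fun i => s (v i)
  | neg φ, s => ¬ φ.Sat s
  | and φ ψ, s => φ.Sat s ∧ ψ.Sat s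
  | or φ ψ, s => φ.Sat s ∨ ψ.Sat s
  | imp φ ψ, s => φ.Sat s → ψ.Sat s
  | all x φ, s => ∀ a : M, φ.Sat (Function.update s x a)
  | ex x φ, s => ∃ a : M, φ.Sat (Function.update s x a)
  | perc q r x y φ, s =>
      (({b : M | Language.Structure.RelMap (L := relLang) (n := 2) r ![s x, b] ∧
          φ.Sat (Function.update s y b)}.ncard : ℕ) : ℚ) =
        q / 100 *
          ({b : M | Language.Structure.RelMap (L := relLang) (n := 2) r ![s x, b]}.ncard : ℕ)

/-- The formula has a finite (nonempty) model. -/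
def FinSat (φ : Formula) : Prop :=
  ∃ (M : Type) (_ : Nonempty M) (_ : Finite M) (_ : relLang.Structure M),
    ∀ s : ℕ → M, φ.Sat s

/-- Atomic formulae: equalities and relational atoms. -/
def IsAtom : Formula → Prop
  | eq _ _ => True
  | rel _ _ => True
  | _ => False

/-- The guarded fragment. -/
inductive GF : Formula → Prop
  | atom {γ : Formula} : γ.IsAtom → GF γ
  | neg {φ : Formula} : GF φ → GF φ.neg
  | and {φ ψ : Formula} : GF φ → GF ψ → GF (φ.and ψ)
  | or {φ ψ : Formula} : GF φ → GF ψ → GF (φ.or ψ)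
  | imp {φ ψ : Formula} : GF φ → GF ψ → GF (φ.imp ψ)
  | all (ys : List ℕ) {γ ψ : Formula} : γ.IsAtom → ψ.free ⊆ γ.free → GF ψ →
      GF (allBlock ys (γ.imp ψ))
  | ex (ys : List ℕ) {γ ψ : Formula} : γ.IsAtom → ψ.free ⊆ γ.free → GF ψ →
      GF (exBlock ys (γ.and ψ))

/-- The guarded fragment with local percentage quantifiers: the rules of the guarded fragment
together with `∃^{=q%}_r y φ(x, y)` for `φ` in the guarded fragment with free variables among
`x, y`. -/
inductive GFLoc : Formula → Prop
  | atom {γ : Formula} : γ.IsAtom → GFLoc γ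
  | neg {φ : Formula} : GFLoc φ → GFLoc φ.neg
  | and {φ ψ : Formula} : GFLoc φ → GFLoc ψ → GFLoc (φ.and ψ)
  | or {φ ψ : Formula} : GFLoc φ → GFLoc ψ → GFLoc (φ.or ψ)
  | imp {φ ψ : Formula} : GFLoc φ → GFLoc ψ → GFLoc (φ.imp ψ)
  | all (ys : List ℕ) {γ ψ : Formula} : γ.IsAtom → ψ.free ⊆ γ.free → GFLoc ψ →
      GFLoc (allBlock ys (γ.imp ψ))
  | ex (ys : List ℕ) {γ ψ : Formula} : γ.IsAtom → ψ.free ⊆ γ.free → GFLoc ψ →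
      GFLoc (exBlock ys (γ.and ψ))
  | perc {q : ℚ} (r : ℕ) {x y : ℕ} {φ : Formula} : 0 ≤ q → q ≤ 100 → x ≠ y →
      φ.free ⊆ {x, y} → GF φ → GFLoc (perc q r x y φ)

/-- The Gödel number of a formula. -/
def code : Formula → ℕ
  | eq x y => Nat.pair 0 (Nat.pair x y)
  | rel r v => Nat.pair 1 (Nat.pair r (Encodable.encode (List.ofFn v)))
  | neg φ => Nat.pair 2 φ.code
  | and φ ψ => Nat.pair 3 (Nat.pair φ.code ψ.code)
  | or φ ψ => Nat.pair 4 (Nat.pair φ.code ψ.code)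
  | imp φ ψ => Nat.pair 5 (Nat.pair φ.code ψ.code)
  | all x φ => Nat.pair 6 (Nat.pair x φ.code)
  | ex x φ => Nat.pair 7 (Nat.pair x φ.code)
  | perc q r x y φ => Nat.pair 8 (Nat.pair (Nat.pair (Encodable.encode q.num) q.den)
      (Nat.pair r (Nat.pair x (Nat.pair y φ.code))))

/-- Different formulae have different Gödel numbers. -/
theorem code_injective : Function.Injective code := by
  intro φ
  induction φ with
  | eq x y => intro ψ h; cases ψ <;> simp_all [code, Nat.pair_eq_pair]
  | @rel n r v =>
    intro ψ h
    cases ψ with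
    | @rel m r' v' =>
      simp only [code, Nat.pair_eq_pair, true_and] at h
      obtain ⟨rfl, h⟩ := h
      have h := Encodable.encode_injective h
      have hn : n = m := by simpa using congrArg List.length h
      subst hn
      rw [List.ofFn_injective h]
    | _ => simp [code, Nat.pair_eq_pair] at h
  | neg φ ih =>
    intro ψ h
    cases ψ <;> simp [code, Nat.pair_eq_pair] at h
    rw [ih h]
  | and φ χ ih1 ih2 | or φ χ ih1 ih2 | imp φ χ ih1 ih2 =>
    intro ψ h
    cases ψ <;> simp [code, Nat.pair_eq_pair] at h
    rw [ih1 h.1, ih2 h.2]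
  | all x φ ih | ex x φ ih =>
    intro ψ h
    cases ψ <;> simp [code, Nat.pair_eq_pair] at h
    rw [h.1, ih h.2]
  | perc q r x y φ ih =>
    intro ψ h
    cases ψ <;> simp [code, Nat.pair_eq_pair] at h
    obtain ⟨⟨h1, h2⟩, rfl, rfl, rfl, h⟩ := h
    rw [ih h, Rat.ext h1 h2]

end Formula

/-- The sentences of the guarded fragment with local percentage quantifiers. -/
def GFLocSentences : Set Formula := {φ | φ.GFLoc ∧ φ.free = ∅}

/-- Its `k`-variable fragment: only the variables `0, …, k - 1` are used (but may be
requantified). -/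
def GFLocVarSentences (k : ℕ) : Set Formula :=
  {φ | φ ∈ GFLocSentences ∧ ∀ x ∈ φ.vars, x < k}

/-- The finite satisfiability problem for the formulae in `C` is decidable: some algorithm gives
the right answer on (the Gödel number of) every formula of `C`; its output on other inputs is
irrelevant. -/
def FinSatDecidable (C : Set Formula) : Prop :=
  ∃ f : ℕ → Bool, Computable f ∧ ∀ φ ∈ C, (f φ.code = true ↔ φ.FinSat)

end PercLogic

/-! The halting problem reduces to finite satisfiability. Some fixed multi-stack machine with
finitely many control states has an undecidable halting problem (`exists_stackMachine_halting`), and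
its input `m` is turned computably into a sentence that has a finite model if and only if the
machine halts (`finSat_haltSentence_iff`).

Percentages serve one purpose. If `R(x,x)` holds, then "exactly 50% of the `R`-successors of `x`
equal `x`" says that `x` has exactly one other `R`-successor (`sat_functional`). So a binary symbol
can encode a partial function without fixed points, whose domain is marked by loops. Guarded
formulae alone cannot force this uniqueness.

Configurations and stack cells become elements linked by such functions. Stack operations require
that two functions take a common value; a ternary guard, which may hold everywhere, makes this
expressible. The function `below`, from a configuration to its second cell, keeps every such
condition at three elements.

In a model, `prev` inverts `step`, and the initial element has no `prev`. The elements representing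
a run are therefore pairwise distinct, so a finite model forces the run to stop (`IsModel.halts`).
Conversely, a halting run gives a finite model made of its times and of the cells of bounded height
(`isModel_run`). Only the description of the input varies with `m`, and its Gödel number is
primitive recursive (`primrec_code_haltSentence`). -/

namespace PercLogic

/-! ### Stack machines and their runs -/

open StateTransition

/-- An operation on one stack. -/
inductive StackOp (Γ : Type) : Type
  | keep : StackOp Γ
  | pop : StackOp Γ
  | push (a : Γ) : StackOp Γ

/-- The effect of an operation on the contents of a stack. -/
def StackOp.apply {Γ : Type} : StackOp Γ → List Γ → List Γ
  | keep, l => l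
  | pop, l => l.tail
  | push a, l => a :: l

/-- A program for finitely many stacks: a control state either halts or names a stack, an
operation on this stack, and the next state depending on the symbol on top of this stack. -/
abbrev StackMachine (Q K Γ : Type) : Type := Q → Option (K × StackOp Γ × (Option Γ → Q))

namespace StackMachine

variable {Q K Γ : Type}

/-- One step of the computation. -/
def step [DecidableEq K] (P : StackMachine Q K Γ) (c : Q × (K → List Γ)) :
    Option (Q × (K → List Γ)) :=
  (P c.1).map fun i =>
    (i.2.2 (c.2 i.1).head?, Function.update c.2 i.1 (i.2.1.apply (c.2 i.1)))

/-- The computation from the configuration `c` terminates. -/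
def Halts [DecidableEq K] (P : StackMachine Q K Γ) (c : Q × (K → List Γ)) : Prop :=
  (eval P.step c).Dom

/-- The restriction of a program to a closed set of control states. -/
def restrict (P : StackMachine Q K Γ) (X : Set Q)
    (hX : ∀ q ∈ X, ∀ i ∈ P q, ∀ o, i.2.2 o ∈ X) : StackMachine X K Γ := fun q =>
  (P q).attach.map fun i => (i.1.1, i.1.2.1, fun o => ⟨i.1.2.2 o, hX q q.2 i.1 i.2 o⟩)

theorem restrict_of_none (P : StackMachine Q K Γ) (X : Set Q)
    (hX : ∀ q ∈ X, ∀ i ∈ P q, ∀ o, i.2.2 o ∈ X) {q : X} (h : P q = none) :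
    P.restrict X hX q = none := by
  simp [restrict, h]

theorem restrict_of_some (P : StackMachine Q K Γ) (X : Set Q)
    (hX : ∀ q ∈ X, ∀ i ∈ P q, ∀ o, i.2.2 o ∈ X) {q : X} {i} (h : P q = some i) :
    P.restrict X hX q = some (i.1, i.2.1, fun o => ⟨i.2.2 o, hX q q.2 i h o⟩) := by
  unfold restrict
  rw [Option.map_eq_some_iff]
  exact ⟨⟨i, h⟩, by simp [Option.attach_eq_some_iff, h], rfl⟩

/-- The sentences need a finite type of control states. Cutting down to a closed set loses nothing,
because the inclusion respects steps. -/
theorem halts_restrict [DecidableEq K] (P : StackMachine Q K Γ) (X : Set Q)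
    (hX : ∀ q ∈ X, ∀ i ∈ P q, ∀ o, i.2.2 o ∈ X) (q : X) (s : K → List Γ) :
    (P.restrict X hX).Halts (q, s) ↔ P.Halts (q, s) := by
  have H : Respects (P.restrict X hX).step P.step fun c d => d = ((c.1 : Q), c.2) := by
    rintro ⟨q, s⟩ _ rfl
    rcases h : P q with _ | i
    · simp [step, h, restrict_of_none P X hX h]
    · simp only [step, restrict_of_some P X hX h, Option.map_some]
      exact ⟨_, rfl, Relation.TransGen.single (by simp [step, h])⟩
  exact (tr_eval_dom H rfl).symm

end StackMachine

/-- Freezing halted configurations makes the step total, so that a run becomes a sequence indexed by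
time. -/
theorem eval_dom_iff_iterate {α : Type} (f : α → Option α) (a : α) :
    (eval f a).Dom ↔ ∃ n, f ((fun c => (f c).getD c)^[n] a) = none := by
  constructor
  · intro h
    obtain ⟨hr, hn⟩ := mem_eval.1 (Part.get_mem h)
    generalize (eval f a).get h = b at hr hn
    clear h
    induction hr using Relation.ReflTransGen.head_induction_on with
    | refl => exact ⟨0, hn⟩
    | head hac _ ih =>
      obtain ⟨n, hn⟩ := ih
      refine ⟨n + 1, ?_⟩
      rw [Function.iterate_succ_apply, Option.mem_def.1 hac]
      exact hn
  · rintro ⟨n, hn⟩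
    refine Part.dom_iff_mem.2 ⟨_, mem_eval.2 ⟨?_, hn⟩⟩
    clear hn
    induction n with
    | zero => exact Relation.ReflTransGen.refl
    | succ n ih =>
      rw [Function.iterate_succ_apply']
      refine ih.trans ?_
      generalize (fun c => (f c).getD c)^[n] a = c
      rcases h : f c with _ | d
      · exact Relation.ReflTransGen.refl
      · exact Relation.ReflTransGen.single h

/-! ### Multi-stack Turing machines as stack machines -/

section TM2

open Turing TM2

variable {K Γ Λ σ : Type}

/-- A multi-stack Turing machine as a stack machine, whose control states are the statement that
remains to be executed together with the value of the internal variable. -/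
def ofTM2 [Inhabited K] (M : Λ → Stmt (fun _ : K => Γ) Λ σ) :
    StackMachine (Option (Stmt (fun _ : K => Γ) Λ σ) × σ) K Γ
  | (none, _) => none
  | (some (.push k f q), v) => some (k, .push (f v), fun _ => (some q, v))
  | (some (.peek k f q), v) => some (k, .keep, fun o => (some q, f v o))
  | (some (.pop k f q), v) => some (k, .pop, fun o => (some q, f v o))
  | (some (.load a q), v) => some (default, .keep, fun _ => (some q, a v))
  | (some (.branch f q₁ q₂), v) => some (default, .keep, fun _ => (some (cond (f v) q₁ q₂), v))
  | (some (.goto l), v) => some (default, .keep, fun _ => (some (M (l v)), v))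
  | (some .halt, v) => some (default, .keep, fun _ => (none, v))

/-- Each constructor of the statement costs exactly one machine step; those that touch no stack keep
the default one. -/
theorem ofTM2_reaches₁ [Inhabited K] [DecidableEq K] (M : Λ → Stmt (fun _ : K => Γ) Λ σ)
    (q : Stmt (fun _ : K => Γ) Λ σ) (v : σ) (s : K → List Γ) :
    Reaches₁ (ofTM2 M).step ((some q, v), s)
      (((stepAux q v s).l.map M, (stepAux q v s).var), (stepAux q v s).stk) := by
  induction q generalizing v s with
  | push k f q ih => exact Relation.TransGen.head rfl (ih _ _)
  | pop k f q ih => exact Relation.TransGen.head rfl (ih _ _)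
  | peek k f q ih =>
    refine Relation.TransGen.head ?_ (ih _ _)
    simp [StackMachine.step, ofTM2, StackOp.apply]
  | load a q ih =>
    refine Relation.TransGen.head ?_ (ih _ _)
    simp [StackMachine.step, ofTM2, StackOp.apply]
  | branch f q₁ q₂ ih₁ ih₂ =>
    have h : (ofTM2 M).step ((some (.branch f q₁ q₂), v), s) =
        some ((some (cond (f v) q₁ q₂), v), s) := by
      simp [StackMachine.step, ofTM2, StackOp.apply]
    rw [stepAux]
    refine Relation.TransGen.head h ?_
    cases f v
    · exact ih₂ _ _
    · exact ih₁ _ _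
  | goto l =>
    refine Relation.TransGen.single ?_
    simp [StackMachine.step, ofTM2, StackOp.apply]
  | halt =>
    refine Relation.TransGen.single ?_
    simp [StackMachine.step, ofTM2, StackOp.apply]

theorem halts_ofTM2 [Inhabited K] [DecidableEq K] (M : Λ → Stmt (fun _ : K => Γ) Λ σ)
    (c : Cfg (fun _ : K => Γ) Λ σ) :
    (ofTM2 M).Halts ((c.l.map M, c.var), c.stk) ↔ (eval (TM2.step M) c).Dom := by
  have H : Respects (TM2.step M) (ofTM2 M).step
      fun c d => d = ((c.l.map M, c.var), c.stk) := by
    rintro ⟨_ | l, v, s⟩ _ rfl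
    · rfl
    · exact ⟨_, rfl, ofTM2_reaches₁ M (M l) v s⟩
  exact tr_eval_dom H rfl

/-- This is the source of finiteness: a finite supporting set of labels has only finitely many
substatements. -/
theorem ofTM2_closed [Inhabited K] [Inhabited Λ] (M : Λ → Stmt (fun _ : K => Γ) Λ σ)
    {S : Finset Λ} (hS : Supports M S) :
    ∀ p ∈ {p : Option (Stmt (fun _ : K => Γ) Λ σ) × σ | p.1 ∈ stmts M S},
      ∀ i ∈ ofTM2 M p, ∀ o, i.2.2 o ∈ {p | p.1 ∈ stmts M S} := by
  rintro ⟨_ | q, v⟩ hp i hi o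
  · simp [ofTM2] at hi
  have hnone : none ∈ stmts M S := by simp [stmts]
  have hsub : ∀ q', q' ∈ stmts₁ q → some q' ∈ stmts M S := fun q' h => stmts_trans h hp
  have hsupp := stmts_supportsStmt hS hp
  cases q with
  | goto l =>
    simp only [ofTM2, Option.mem_def, Option.some.injEq] at hi
    subst hi
    have hl : l v ∈ S := hsupp v
    simp only [Set.mem_ofPred_eq, stmts, Finset.mem_insertNone, Finset.mem_biUnion, Option.mem_def,
      Option.some.injEq, forall_eq']
    exact ⟨l v, hl, stmts₁_self⟩
  | halt =>
    simp only [ofTM2, Option.mem_def, Option.some.injEq] at hi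
    subst hi
    exact hnone
  | branch f q₁ q₂ =>
    simp only [ofTM2, Option.mem_def, Option.some.injEq] at hi
    subst hi
    apply hsub
    simp only [stmts₁, Finset.mem_insert, Finset.mem_union]
    cases f v
    · exact .inr (.inr stmts₁_self)
    · exact .inr (.inl stmts₁_self)
  | push | peek | pop | load =>
    simp only [ofTM2, Option.mem_def, Option.some.injEq] at hi
    subst hi
    apply hsub
    simp only [stmts₁, Finset.mem_insert]
    exact .inr stmts₁_self

end TM2

/-! ### A machine with undecidable halting on unary inputs -/

theorem trNat_two_pow_sub_one (m : ℕ) :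
    Turing.PartrecToTM2.trNat (2 ^ m - 1) = List.replicate m Turing.PartrecToTM2.Γ'.bit1 := by
  induction m with
  | zero => simp
  | succ m ih =>
    have h1 : 2 ^ (m + 1) - 1 = (2 ^ m - 1) + (2 ^ m - 1) + 1 := by
      have := Nat.one_le_two_pow (n := m)
      omega
    have h2 : ∀ n : Num, Turing.PartrecToTM2.trNum n.bit1 =
        Turing.PartrecToTM2.Γ'.bit1 :: Turing.PartrecToTM2.trNum n := by
      intro n
      cases n <;> rfl
    rw [h1, Turing.PartrecToTM2.trNat, Nat.cast_add, Nat.cast_add, Nat.cast_one,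
      Num.bit1_of_bit1, h2, List.replicate_succ, ← ih, Turing.PartrecToTM2.trNat]

/-- The translated machine stores binary digits. Feeding it `2 ^ m - 1` makes the stack a repetition
of one digit, so that the input formula iterates one construction. -/
theorem exists_toPartrec_code_halting : ∃ c : Turing.ToPartrec.Code, ∀ m : ℕ,
    (c.eval [2 ^ m - 1]).Dom ↔
      ((Denumerable.ofNat Nat.Partrec.Code m).eval 0).Dom := by
  obtain ⟨g, hg, hgm⟩ : ∃ g : ℕ → ℕ, Primrec g ∧ ∀ m, g (2 ^ m - 1) = m := by
    -- The binary logarithm of `n + 1`; searching up to `n` suffices because `m ≤ 2 ^ m - 1`.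
    refine ⟨fun n => Nat.findGreatest (fun k => 2 ^ k ≤ n + 1) n,
      Primrec.nat_findGreatest Primrec.id <| Primrec.nat_le.comp
        ((Primrec₂.unpaired'.1 Nat.Primrec.pow).comp (Primrec.const 2) Primrec.snd)
        (Primrec.succ.comp Primrec.fst), fun m => ?_⟩
    have hlt := Nat.lt_two_pow_self (n := m)
    rw [Nat.findGreatest_eq_iff, Nat.sub_add_cancel (by omega)]
    exact ⟨by omega, fun _ => le_rfl, fun n hn _ =>
      not_le.2 (Nat.pow_lt_pow_right (by norm_num) hn)⟩
  have hf : Partrec fun n : ℕ => (Denumerable.ofNat Nat.Partrec.Code (g n)).eval 0 :=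
    Nat.Partrec.Code.eval_part.comp ((Computable.ofNat _).comp hg.to_comp) (Computable.const 0)
  obtain ⟨c, hc⟩ := Turing.ToPartrec.Code.exists_code (Nat.Partrec'.part_iff₁.2 hf)
  refine ⟨c, fun m => ?_⟩
  have hm : g (List.Vector.head ⟨[2 ^ m - 1], rfl⟩) = m := hgm m
  rw [hc ⟨[2 ^ m - 1], rfl⟩, hm]
  rfl

open Turing.PartrecToTM2 in
theorem exists_stackMachine_halting :
    ∃ (Q K Γ : Type) (_ : Finite Q) (_ : Finite K) (_ : Finite Γ) (_ : DecidableEq K)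
      (P : StackMachine Q K Γ) (q₀ : Q) (k₀ : K) (a e : Γ), ∀ m : ℕ,
      P.Halts (q₀, Function.update (fun _ => []) k₀ (List.replicate m a ++ [e])) ↔
        ((Denumerable.ofNat Nat.Partrec.Code m).eval 0).Dom := by
  obtain ⟨c, hc⟩ := exists_toPartrec_code_halting
  let : Inhabited Λ' := ⟨trNormal c Cont'.halt⟩
  have hS := tr_supports c Cont'.halt
  have hK : Finite K' := Finite.of_surjective
    (fun i : Fin 4 => ![K'.main, K'.rev, K'.aux, K'.stack] i) fun k => by
      cases k
      exacts [⟨0, rfl⟩, ⟨1, rfl⟩, ⟨2, rfl⟩, ⟨3, rfl⟩]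
  have hX := ofTM2_closed tr hS
  have hq : ((some (tr (trNormal c Cont'.halt)), none) :
      Option (Turing.TM2.Stmt (fun _ : K' => Γ') Λ' (Option Γ')) × Option Γ') ∈
      {p | p.1 ∈ Turing.TM2.stmts tr (codeSupp c Cont'.halt)} := by
    simp only [Set.mem_ofPred_eq, Turing.TM2.stmts, Finset.mem_insertNone, Finset.mem_biUnion,
      Option.mem_def]
    rintro _ ⟨⟩
    exact ⟨_, hS.1, Turing.TM2.stmts₁_self⟩
  have hQ : Finite {p : Option (Turing.TM2.Stmt (fun _ : K' => Γ') Λ' (Option Γ')) × Option Γ' |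
      p.1 ∈ Turing.TM2.stmts tr (codeSupp c Cont'.halt)} := by
    refine Set.Finite.to_subtype (((Finset.finite_toSet
      (Turing.TM2.stmts tr (codeSupp c Cont'.halt))).prod Set.finite_univ).subset ?_)
    intro p hp
    exact ⟨hp, trivial⟩
  -- `Γ'.cons` closes the single entry of the input list, hence plays the role of `e`.
  refine ⟨_, K', Γ', hQ, hK, inferInstance, inferInstance, (ofTM2 tr).restrict _ hX, ⟨_, hq⟩,
    K'.main, Γ'.bit1, Γ'.cons, fun m => ?_⟩
  rw [StackMachine.halts_restrict, ← hc]
  have h := halts_ofTM2 tr (init c [2 ^ m - 1])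
  rw [Turing.PartrecToTM2.tr_eval] at h
  refine Iff.trans (Eq.to_iff ?_) h
  congr 2
  funext k
  cases k <;> simp [init, trList, trNat_two_pow_sub_one]

end PercLogic

/-! ### The sentences of the reduction -/

namespace PercLogic

open FirstOrder Formula

/-- Unary predicates: the initial configuration, the configurations in a control state, and the
stack cells with a symbol (`none` marks the cells below the bottom of a stack). -/
inductive Label (Q Γ : Type) : Type
  | init : Label Q Γ
  | state (q : Q) : Label Q Γ
  | sym (o : Option Γ) : Label Q Γ

/-- Binary predicates, which stand for partial functions: the cell on top of the stack `k` of a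
configuration, the cell below it, the cell below a cell, the next configuration and the
previous one. -/
inductive FunSym (K : Type) : Type
  | top (k : K) : FunSym K
  | below (k : K) : FunSym K
  | next : FunSym K
  | step : FunSym K
  | prev : FunSym K

instance (Q Γ : Type) [Finite Q] [Finite Γ] : Finite (Label Q Γ) :=
  Finite.of_surjective (α := Option (Q ⊕ Option Γ))
    (fun | none => .init | some (.inl q) => .state q | some (.inr o) => .sym o) fun
    | .init => ⟨none, rfl⟩
    | .state q => ⟨some (.inl q), rfl⟩
    | .sym o => ⟨some (.inr o), rfl⟩

instance (K : Type) [Finite K] : Finite (FunSym K) :=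
  Finite.of_surjective (α := (K ⊕ K) ⊕ Option Bool)
    (fun
      | .inl (.inl k) => .top k | .inl (.inr k) => .below k
      | .inr none => .next | .inr (some true) => .step | .inr (some false) => .prev) fun
    | .top k => ⟨.inl (.inl k), rfl⟩
    | .below k => ⟨.inl (.inr k), rfl⟩
    | .next => ⟨.inr none, rfl⟩
    | .step => ⟨.inr (some true), rfl⟩
    | .prev => ⟨.inr (some false), rfl⟩

/-- An injective numbering of a finite type. -/
noncomputable def index {α : Type} [Finite α] (a : α) : ℕ := Finite.equivFin α a

theorem index_injective {α : Type} [Finite α] : Function.Injective (index : α → ℕ) :=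
  Fin.val_injective.comp (Finite.equivFin α).injective

/-- A valid sentence. -/
def verum : Formula := allBlock [0] ((eq 0 0).imp (eq 0 0))

/-- The conjunction of a finite family of formulae. -/
noncomputable def conj {ι : Type} [Finite ι] (F : ι → Formula) : Formula :=
  (((Set.toFinite (Set.univ : Set ι)).toFinset.toList.map F).foldr Formula.and verum)

theorem sat_conj {ι : Type} [Finite ι] (F : ι → Formula) {M : Type} [relLang.Structure M]
    (s : ℕ → M) : (conj F).Sat s ↔ ∀ i, (F i).Sat s := by
  have key : ∀ l : List ι, ((l.map F).foldr Formula.and verum).Sat s ↔ ∀ i ∈ l, (F i).Sat s := by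
    intro l
    induction l with
    | nil => simp [verum, allBlock, Sat]
    | cons i l ih => simp [Sat, ih]
  simp [conj, key]

section Formulas

variable {Q K Γ : Type} [Finite Q] [Finite K] [Finite Γ]

/-- The atom `l(x)`. -/
noncomputable def lab (l : Label Q Γ) (x : ℕ) : Formula := rel (n := 1) (index l) ![x]

/-- The atom `f(x, y)`. -/
noncomputable def edge (f : FunSym K) (x y : ℕ) : Formula := rel (n := 2) (index f) ![x, y]

/-- An atom that serves as a guard for all three variables. -/
def guard : Formula := rel (n := 3) 0 ![0, 1, 2]

/-- The partial function `f` maps `x` to `y`. -/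
noncomputable def app (f : FunSym K) (x y : ℕ) : Formula :=
  (edge f x x).and ((edge f x y).and (eq x y).neg)

/-- The sentence saying that `f` describes a partial function. -/
noncomputable def functional (f : FunSym K) : Formula :=
  allBlock [0] ((edge f 0 0).imp (perc 50 (index f) 0 1 (eq 0 1)))

/-- For all `x` and `y`, if `f` maps `x` to `y` then `φ`. -/
noncomputable def rule (f : FunSym K) (φ : Formula) : Formula :=
  allBlock [0, 1] ((edge f 0 1).imp ((app f 0 1).imp φ))

/-- For all `x` with `l(x)`, `φ`. -/
noncomputable def labRule (l : Label Q Γ) (φ : Formula) : Formula :=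
  allBlock [0] ((lab l 0).imp φ)

/-- There is a `y` such that `f` maps `x` to `y`, and `φ`. -/
noncomputable def wit (f : FunSym K) (x y : ℕ) (φ : Formula) : Formula :=
  exBlock [y] ((edge f x y).and ((app f x y).and φ))

/-- There is a `z` to which `f` maps `x` and `g` maps `y`. -/
noncomputable def meet (f : FunSym K) (x : ℕ) (g : FunSym K) (y : ℕ) : Formula :=
  exBlock [2] (guard.and ((app f x 2).and (app g y 2)))

/-- The relation between the stack `k` of consecutive configurations. -/
noncomputable def opFormula (Q : Type) [Finite Q] (k : K) : StackOp Γ → Formula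
  | .keep => meet (.top k) 0 (.top k) 1
  | .pop => meet (.below k) 0 (.top k) 1
  | .push a => (meet (.top k) 0 (.below k) 1).and
      (wit (.top k) 1 2 (lab (.sym (some a) : Label Q Γ) 2))

/-- The sentence describing the transitions from the control state `q`. -/
noncomputable def stateSentence [DecidableEq K] (P : StackMachine Q K Γ) (q : Q) : Formula :=
  match P q with
  | none => verum
  | some (k, op, g) =>
    (labRule (.state q : Label Q Γ) (edge (.step : FunSym K) 0 0)).and <|
    (conj fun o => rule (.step : FunSym K) (((lab (.state q : Label Q Γ) 0).and
      (wit (.top k) 0 2 (lab (.sym o : Label Q Γ) 2))).imp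
        (lab (.state (g o) : Label Q Γ) 1))).and <|
    conj fun k' => rule (.step : FunSym K) ((lab (.state q : Label Q Γ) 0).imp
      (opFormula Q k' (if k' = k then op else .keep)))

variable (Q K Γ) in
/-- The sentence describing the data structures. -/
noncomputable def dataSentence : Formula :=
  (conj fun f : FunSym K => functional f).and <|
  (conj fun k : K => rule (.top k) (meet (.next : FunSym K) 1 (.below k) 0)).and <|
  (labRule (.sym none : Label Q Γ) (edge (.next : FunSym K) 0 0)).and <|
  (rule (.next : FunSym K) ((lab (.sym none : Label Q Γ) 0).imp
    (lab (.sym none : Label Q Γ) 1))).and <|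
  rule (.step : FunSym K) (app (.prev : FunSym K) 1 0)

/-- The formula saying that `m` cells with the symbol `a`, one with the symbol `e` and the bottom
of the stack follow each other, starting with `y`. -/
noncomputable def chain (Q K : Type) [Finite Q] [Finite K] (a e : Γ) : ℕ → Formula
  | 0 => (lab (.sym (some e) : Label Q Γ) 1).and
      (wit (.next : FunSym K) 1 0 (lab (.sym none : Label Q Γ) 0))
  | m + 1 => (lab (.sym (some a) : Label Q Γ) 1).and
      (wit (.next : FunSym K) 1 0 (exBlock [1] ((eq 1 0).and (chain Q K a e m))))

variable (K Γ) in
/-- The sentence describing the initial configuration up to the input. -/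
noncomputable def initSentence (q₀ : Q) (k₀ : K) : Formula :=
  (exBlock [0] ((lab (.init : Label Q Γ) 0).and (lab (.state q₀ : Label Q Γ) 0))).and <|
  (labRule (.init : Label Q Γ) (edge (.prev : FunSym K) 0 0).neg).and <|
  conj fun k : {k // k ≠ k₀} => labRule (.init : Label Q Γ)
    (wit (.top k.1) 0 1 (lab (.sym none : Label Q Γ) 1))

/-- The sentence describing the input. -/
noncomputable def inputSentence (Q : Type) [Finite Q] (k₀ : K) (a e : Γ) (m : ℕ) : Formula :=
  labRule (.init : Label Q Γ) (wit (.top k₀) 0 1 (chain Q K a e m))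

/-- The part of the reduction that does not depend on the input. -/
noncomputable def machineSentence [DecidableEq K] (P : StackMachine Q K Γ) (q₀ : Q) (k₀ : K) :
    Formula :=
  (dataSentence Q K Γ).and ((conj (stateSentence P)).and (initSentence K Γ q₀ k₀))

/-- The sentence that has a finite model if and only if the machine halts. -/
noncomputable def haltSentence [DecidableEq K] (P : StackMachine Q K Γ) (q₀ : Q) (k₀ : K)
    (a e : Γ) (m : ℕ) : Formula :=
  (machineSentence P q₀ k₀).and (inputSentence Q k₀ a e m)

/-! ### Membership in the fragment -/

/-- A formula of the three-variable fragment with free variables among those in `X`. -/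
structure IsTernaryOn (X : Finset ℕ) (φ : Formula) : Prop where
  gfLoc : φ.GFLoc
  free_sub : φ.free ⊆ X
  vars_lt : ∀ x ∈ φ.vars, x < 3
  arityLE : φ.ArityLE 3

namespace IsTernaryOn

variable {X Y : Finset ℕ} {φ ψ : Formula}

theorem mono (h : IsTernaryOn X φ) (hXY : X ⊆ Y) : IsTernaryOn Y φ :=
  ⟨h.gfLoc, h.free_sub.trans hXY, h.vars_lt, h.arityLE⟩

theorem lab (l : Label Q Γ) {x : ℕ} (hx : x < 3) (hX : x ∈ X) : IsTernaryOn X (lab l x) where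
  gfLoc := .atom trivial
  free_sub := by simp [PercLogic.lab, free, hX]
  vars_lt := by simp [PercLogic.lab, vars, hx]
  arityLE := by simp [PercLogic.lab, ArityLE]

theorem edge (f : FunSym K) {x y : ℕ} (hx : x < 3) (hy : y < 3) (hX : x ∈ X) (hY : y ∈ X) :
    IsTernaryOn X (edge f x y) where
  gfLoc := .atom trivial
  free_sub := by
    intro i
    simp only [PercLogic.edge, free, Finset.mem_image, Finset.mem_univ, true_and,
      Fin.exists_fin_two]
    rintro (rfl | rfl) <;> simpa
  vars_lt := by
    intro i
    simp only [PercLogic.edge, vars, Finset.mem_image, Finset.mem_univ, true_and,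
      Fin.exists_fin_two]
    rintro (rfl | rfl) <;> simpa
  arityLE := by simp [PercLogic.edge, ArityLE]

theorem eq {x y : ℕ} (hx : x < 3) (hy : y < 3) (hX : x ∈ X) (hY : y ∈ X) :
    IsTernaryOn X (eq x y) where
  gfLoc := .atom trivial
  free_sub := by simp [free, Finset.insert_subset_iff, hX, hY]
  vars_lt := by simp [vars, hx, hy]
  arityLE := trivial

theorem neg (h : IsTernaryOn X φ) : IsTernaryOn X φ.neg :=
  ⟨.neg h.gfLoc, h.free_sub, h.vars_lt, h.arityLE⟩

theorem and (hφ : IsTernaryOn X φ) (hψ : IsTernaryOn X ψ) : IsTernaryOn X (φ.and ψ) where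
  gfLoc := .and hφ.gfLoc hψ.gfLoc
  free_sub := Finset.union_subset hφ.free_sub hψ.free_sub
  vars_lt x hx := (Finset.mem_union.1 hx).elim (hφ.vars_lt x) (hψ.vars_lt x)
  arityLE := ⟨hφ.arityLE, hψ.arityLE⟩

theorem imp (hφ : IsTernaryOn X φ) (hψ : IsTernaryOn X ψ) : IsTernaryOn X (φ.imp ψ) where
  gfLoc := .imp hφ.gfLoc hψ.gfLoc
  free_sub := Finset.union_subset hφ.free_sub hψ.free_sub
  vars_lt x hx := (Finset.mem_union.1 hx).elim (hφ.vars_lt x) (hψ.vars_lt x)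
  arityLE := ⟨hφ.arityLE, hψ.arityLE⟩

theorem app (f : FunSym K) {x y : ℕ} (hx : x < 3) (hy : y < 3) (hX : x ∈ X) (hY : y ∈ X) :
    IsTernaryOn X (app f x y) :=
  (edge f hx hx hX hX).and ((edge f hx hy hX hY).and (eq hx hy hX hY).neg)

theorem exBlock {y : ℕ} (hy : y < 3) {γ : Formula} (hγ : γ.IsAtom) (h : IsTernaryOn γ.free ψ)
    (h' : IsTernaryOn (insert y X) γ) : IsTernaryOn X (exBlock [y] (γ.and ψ)) where
  gfLoc := .ex _ hγ h.free_sub h.gfLoc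
  free_sub := by
    have := h.free_sub
    have := h'.free_sub
    simp only [Formula.exBlock, List.foldr, free]
    grind
  vars_lt := by
    have := h.vars_lt
    have := h'.vars_lt
    simp only [Formula.exBlock, List.foldr, vars]
    grind
  arityLE := ⟨h'.arityLE, h.arityLE⟩

theorem allBlock {ys : List ℕ} (hy : ∀ y ∈ ys, y < 3) {γ : Formula} (hγ : γ.IsAtom)
    (h : IsTernaryOn γ.free ψ) (h' : IsTernaryOn (ys.toFinset ∪ X) γ) :
    IsTernaryOn X (allBlock ys (γ.imp ψ)) where
  gfLoc := .all _ hγ h.free_sub h.gfLoc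
  free_sub := by
    have key : ∀ (ys : List ℕ) (φ : Formula),
        (Formula.allBlock ys φ).free = φ.free \ ys.toFinset := by
      intro ys φ
      induction ys with
      | nil => simp [Formula.allBlock]
      | cons y ys ih =>
        simp only [Formula.allBlock, List.foldr, free] at ih ⊢
        rw [ih]
        ext
        simp
        tauto
    have := h.free_sub
    have := h'.free_sub
    rw [key]
    simp only [free]
    grind
  vars_lt := by
    have key : ∀ (ys : List ℕ) (φ : Formula),
        (Formula.allBlock ys φ).vars = φ.vars ∪ ys.toFinset := by
      intro ys φ
      induction ys with
      | nil => simp [Formula.allBlock]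
      | cons y ys ih =>
        simp only [Formula.allBlock, List.foldr, vars] at ih ⊢
        rw [ih]
        ext
        simp
    have := h.vars_lt
    have := h'.vars_lt
    rw [key]
    simp only [vars]
    grind [List.mem_toFinset]
  arityLE := by
    have key : ∀ (ys : List ℕ) (φ : Formula),
        (Formula.allBlock ys φ).ArityLE 3 ↔ φ.ArityLE 3 := by
      intro ys φ
      induction ys with
      | nil => rfl
      | cons y ys ih => exact ih
    exact (key _ _).2 ⟨h'.arityLE, h.arityLE⟩

theorem free_edge (f : FunSym K) (x y : ℕ) : (PercLogic.edge f x y).free = {x, y} := by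
  ext
  simp [PercLogic.edge, free, eq_comm]

theorem free_lab (l : Label Q Γ) (x : ℕ) : (PercLogic.lab l x).free = {x} := by
  simp [PercLogic.lab, free]

theorem rule (f : FunSym K) (h : IsTernaryOn {0, 1} φ) : IsTernaryOn ∅ (rule f φ) := by
  refine allBlock (by simp) trivial ?_ (edge f (by simp) (by simp) (by simp) (by simp))
  rw [free_edge]
  exact (app f (by simp) (by simp) (by simp) (by simp)).imp h

theorem labRule (l : Label Q Γ) (h : IsTernaryOn {0} φ) : IsTernaryOn ∅ (labRule l φ) := by
  refine allBlock (by simp) trivial ?_ (lab l (by simp) (by simp))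
  rwa [free_lab]

theorem wit (f : FunSym K) {x y : ℕ} (hx : x < 3) (hy : y < 3) (hX : x ∈ X)
    (h : IsTernaryOn {x, y} φ) : IsTernaryOn X (wit f x y φ) := by
  refine exBlock hy trivial ?_ (edge f hx hy (by simp [hX]) (by simp))
  rw [free_edge]
  exact (app f hx hy (by simp) (by simp)).and h

theorem meet (f g : FunSym K) {x y : ℕ} (hx : x < 2) (hy : y < 2) (hX : {0, 1} ⊆ X) :
    IsTernaryOn X (meet f x g y) := by
  have hfree : guard.free = {0, 1, 2} := by decide
  refine exBlock (by simp) trivial ?_ ⟨.atom trivial, ?_, by decide, le_rfl⟩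
  · rw [hfree]
    have hx' : x ∈ ({0, 1, 2} : Finset ℕ) := by simp; omega
    have hy' : y ∈ ({0, 1, 2} : Finset ℕ) := by simp; omega
    exact (app f (by omega) (by simp) hx' (by simp)).and
      (app g (by omega) (by simp) hy' (by simp))
  · rw [hfree]
    grind

theorem opFormula (k : K) (op : StackOp Γ) : IsTernaryOn {0, 1} (opFormula Q k op) := by
  cases op with
  | keep | pop => exact meet _ _ (by simp) (by simp) (by simp)
  | push a =>
    exact .and (meet _ _ (by simp) (by simp) (by simp))
      (wit _ (by simp) (by simp) (by simp) (lab _ (by simp) (by simp)))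

/-- The next cell is called 0 and then renamed 1 by an equality guard. Two variables thus suffice
for every length, and each level wraps the previous one in the same way. -/
theorem chain (a e : Γ) (m : ℕ) : IsTernaryOn {1} (chain Q K a e m) := by
  induction m with
  | zero =>
    exact (lab _ (by simp) (by simp)).and
      (wit _ (by simp) (by simp) (by simp) (lab _ (by simp) (by simp)))
  | succ m ih =>
    exact (lab _ (by simp) (by simp)).and (wit _ (by simp) (by simp) (by simp)
      (exBlock (by simp) trivial (ih.mono (by simp [free]))
        (eq (by simp) (by simp) (by simp) (by simp))))

theorem verum : IsTernaryOn ∅ verum :=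
  allBlock (by simp) trivial (eq (by simp) (by simp) (by simp [free]) (by simp [free]))
    (eq (by simp) (by simp) (by simp) (by simp))

theorem conj {ι : Type} [Finite ι] {F : ι → Formula} (h : ∀ i, IsTernaryOn ∅ (F i)) :
    IsTernaryOn ∅ (conj F) := by
  unfold PercLogic.conj
  induction (Set.toFinite (Set.univ : Set ι)).toFinset.toList with
  | nil => exact verum
  | cons i l ih => exact (h i).and ih

theorem functional (f : FunSym K) : IsTernaryOn ∅ (functional f) := by
  refine .allBlock (by simp) trivial ?_ (.edge f (by simp) (by simp) (by simp) (by simp))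
  rw [free_edge]
  exact ⟨.perc _ (by norm_num) (by norm_num) (by simp) (by simp [free]) (.atom trivial),
    by simp only [free]; decide, by simp [vars], by simp [ArityLE]⟩

theorem dataSentence : IsTernaryOn ∅ (dataSentence Q K Γ) := by
  refine .and (.conj .functional) (.and (.conj fun k => .rule _ (.meet _ _ ?_ ?_ ?_))
    (.and (.labRule _ (.edge _ ?_ ?_ ?_ ?_)) (.and (.rule _ (.imp (.lab _ ?_ ?_) (.lab _ ?_ ?_)))
      (.rule _ (.app _ ?_ ?_ ?_ ?_))))) <;> simp

theorem stateSentence [DecidableEq K] (P : StackMachine Q K Γ) (q : Q) :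
    IsTernaryOn ∅ (stateSentence P q) := by
  unfold PercLogic.stateSentence
  split
  · exact verum
  · refine .and (.labRule _ (.edge _ ?_ ?_ ?_ ?_)) (.and (.conj fun o => .rule _ (.imp (.and
      (.lab _ ?_ ?_) (.wit _ ?_ ?_ ?_ (.lab _ ?_ ?_))) (.lab _ ?_ ?_)))
        (.conj fun k' => .rule _ (.imp (.lab _ ?_ ?_) (.opFormula _ _)))) <;> simp

theorem initSentence (q₀ : Q) (k₀ : K) : IsTernaryOn ∅ (initSentence K Γ q₀ k₀) := by
  refine .and (.exBlock ?_ trivial (.lab _ ?_ ?_) (.lab _ ?_ ?_))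
    (.and (.labRule _ (.neg (.edge _ ?_ ?_ ?_ ?_))) (.conj fun k => .labRule _
      (.wit _ ?_ ?_ ?_ (.lab _ ?_ ?_)))) <;> simp [free_lab]

theorem inputSentence (k₀ : K) (a e : Γ) (m : ℕ) : IsTernaryOn ∅ (inputSentence Q k₀ a e m) :=
  .labRule _ (.wit _ (by simp) (by simp) (by simp) ((chain a e m).mono (by simp)))

theorem haltSentence [DecidableEq K] (P : StackMachine Q K Γ) (q₀ : Q) (k₀ : K)
    (a e : Γ) (m : ℕ) : IsTernaryOn ∅ (haltSentence P q₀ k₀ a e m) :=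
  .and (.and dataSentence (.and (.conj (stateSentence P)) (initSentence q₀ k₀)))
    (inputSentence k₀ a e m)

end IsTernaryOn

end Formulas

end PercLogic

/-! ### The meaning of the sentences -/

namespace PercLogic

open FirstOrder Formula

section Semantics

variable {Q K Γ M : Type}

/-- The partial function described by the relation `E f` maps `x` to `y`. -/
def App (E : FunSym K → M → M → Prop) (f : FunSym K) (x y : M) : Prop :=
  E f x x ∧ E f x y ∧ x ≠ y

/-- There is a guarded `z` to which `f` maps `x` and `g` maps `y`. -/
def Meet (E : FunSym K → M → M → Prop) (G : M → Prop) (f : FunSym K) (x : M) (g : FunSym K)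
    (y : M) : Prop := ∃ z, G z ∧ App E f x z ∧ App E g y z

/-- The relation between the stack `k` of the consecutive configurations `x` and `y`. -/
def OpRel (L : Label Q Γ → M → Prop) (E : FunSym K → M → M → Prop) (G : M → Prop) (k : K)
    (x y : M) : StackOp Γ → Prop
  | .keep => Meet E G (.top k) x (.top k) y
  | .pop => Meet E G (.below k) x (.top k) y
  | .push a => Meet E G (.top k) x (.below k) y ∧
      ∃ z, App E (.top k) y z ∧ L (.sym (some a)) z

/-- The cell `x` is followed by `m` further cells as described by `chain`. -/
def ChainRel (L : Label Q Γ → M → Prop) (E : FunSym K → M → M → Prop) (a e : Γ) : ℕ → M → Prop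
  | 0, x => L (.sym (some e)) x ∧ ∃ y, App E .next x y ∧ L (.sym none) y
  | m + 1, x => L (.sym (some a)) x ∧ ∃ y, App E .next x y ∧ ChainRel L E a e m y

/-- The meaning of `haltSentence`. -/
structure IsModel [DecidableEq K] (P : StackMachine Q K Γ) (q₀ : Q) (k₀ : K) (a e : Γ) (m : ℕ)
    (L : Label Q Γ → M → Prop) (E : FunSym K → M → M → Prop) (G : M → M → M → Prop) : Prop where
  functional : ∀ f x, E f x x → ∃! y, App E f x y
  below : ∀ k x y, App E (.top k) x y → Meet E (G x y) .next y (.below k) x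
  bottom_next : ∀ x, L (.sym none) x → E .next x x
  bottom_below : ∀ x y, App E .next x y → L (.sym none) x → L (.sym none) y
  prev : ∀ x y, App E .step x y → App E .prev y x
  progress : ∀ q k op g, P q = some (k, op, g) → ∀ x, L (.state q) x → E .step x x
  state : ∀ q k op g, P q = some (k, op, g) → ∀ o x y, App E .step x y → L (.state q) x →
    ∀ z, App E (.top k) x z → L (.sym o) z → L (.state (g o)) y
  stack : ∀ q k op g, P q = some (k, op, g) → ∀ k' x y, App E .step x y → L (.state q) x →
    OpRel L E (G x y) k' x y (if k' = k then op else .keep)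
  exists_init : ∃ x, L .init x ∧ L (.state q₀) x
  init_prev : ∀ x, L .init x → ¬ E .prev x x
  init_empty : ∀ k, k ≠ k₀ → ∀ x, L .init x → ∃ y, App E (.top k) x y ∧ L (.sym none) y
  init_input : ∀ x, L .init x → ∃ y, App E (.top k₀) x y ∧ ChainRel L E a e m y

variable [Finite Q] [Finite K] [Finite Γ] [relLang.Structure M]

/-- The interpretation of the unary symbols. -/
def labRel (M : Type) [relLang.Structure M] (l : Label Q Γ) (x : M) : Prop :=
  Language.Structure.RelMap (L := relLang) (n := 1) (index l) ![x]

/-- The interpretation of the binary symbols. -/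
def edgeRel (M : Type) [relLang.Structure M] (f : FunSym K) (x y : M) : Prop :=
  Language.Structure.RelMap (L := relLang) (n := 2) (index f) ![x, y]

/-- The interpretation of the ternary symbol. -/
def guardRel (M : Type) [relLang.Structure M] (x y z : M) : Prop :=
  Language.Structure.RelMap (L := relLang) (n := 3) (0 : ℕ) ![x, y, z]

theorem sat_lab (l : Label Q Γ) (x : ℕ) (s : ℕ → M) : (lab l x).Sat s ↔ labRel M l (s x) := by
  rw [lab, Sat, labRel]
  refine Eq.to_iff (congrArg _ (funext fun i => ?_))
  fin_cases i
  rfl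

theorem sat_edge (f : FunSym K) (x y : ℕ) (s : ℕ → M) :
    (edge f x y).Sat s ↔ edgeRel M f (s x) (s y) := by
  rw [edge, Sat, edgeRel]
  refine Eq.to_iff (congrArg _ (funext fun i => ?_))
  fin_cases i <;> rfl

theorem sat_guard (s : ℕ → M) : guard.Sat s ↔ guardRel M (s 0) (s 1) (s 2) := by
  rw [guard, Sat, guardRel]
  refine Eq.to_iff (congrArg _ (funext fun i => ?_))
  fin_cases i <;> rfl

theorem sat_app (f : FunSym K) (x y : ℕ) (s : ℕ → M) :
    (app f x y).Sat s ↔ App (edgeRel M) f (s x) (s y) := by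
  simp only [app, Sat, sat_edge, App, ne_eq]

theorem sat_rule (f : FunSym K) (φ : Formula) (s : ℕ → M) :
    (rule f φ).Sat s ↔ ∀ x y, App (edgeRel M) f x y →
      φ.Sat (Function.update (Function.update s 0 x) 1 y) := by
  simp only [rule, allBlock, List.foldr, Sat, sat_edge, sat_app, Function.update_self, ne_eq,
    zero_ne_one, not_false_eq_true, Function.update_of_ne]
  exact forall₂_congr fun x y => ⟨fun h h' => h h'.2.1 h', fun h _ => h⟩

theorem sat_labRule (l : Label Q Γ) (φ : Formula) (s : ℕ → M) :
    (labRule l φ).Sat s ↔ ∀ x, labRel M l x → φ.Sat (Function.update s 0 x) := by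
  simp only [labRule, allBlock, List.foldr, Sat, sat_lab, Function.update_self]

theorem sat_wit (f : FunSym K) {x y : ℕ} (hxy : x ≠ y) (φ : Formula) (s : ℕ → M) :
    (wit f x y φ).Sat s ↔ ∃ z, App (edgeRel M) f (s x) z ∧ φ.Sat (Function.update s y z) := by
  simp only [wit, exBlock, List.foldr, Sat, sat_edge, sat_app, Function.update_self, ne_eq,
    hxy, not_false_eq_true, Function.update_of_ne]
  exact exists_congr fun z => ⟨fun h => h.2, fun h => ⟨h.1.2.1, h⟩⟩

theorem sat_meet (f g : FunSym K) {x y : ℕ} (hx : x ≠ 2) (hy : y ≠ 2) (s : ℕ → M) :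
    (meet f x g y).Sat s ↔ Meet (edgeRel M) (guardRel M (s 0) (s 1)) f (s x) g (s y) := by
  simp [meet, exBlock, Sat, sat_guard, sat_app, Meet, hx, hy]

theorem sat_opFormula (k : K) (op : StackOp Γ) (s : ℕ → M) : (opFormula Q k op).Sat s ↔
    OpRel (labRel M : Label Q Γ → M → Prop) (edgeRel M) (guardRel M (s 0) (s 1)) k (s 0) (s 1)
      op := by
  cases op <;> simp [opFormula, OpRel, sat_meet, sat_wit, Sat, sat_lab]

theorem sat_chain (a e : Γ) (m : ℕ) (s : ℕ → M) : (chain Q K a e m).Sat s ↔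
    ChainRel (labRel M : Label Q Γ → M → Prop) (edgeRel M : FunSym K → _) a e m (s 1) := by
  induction m generalizing s with
  | zero => simp [chain, ChainRel, Sat, sat_lab, sat_wit]
  | succ m ih => simp [chain, ChainRel, Sat, sat_lab, sat_wit, exBlock, ih]

/-- With a loop at `x`, the successors of `x` are `x` itself and the `k` values of `f`, and only `x`
satisfies the equality. The 50% condition reads `1 = (k + 1) / 2`, that is, `k = 1`. -/
theorem sat_functional [Finite M] (f : FunSym K) (s : ℕ → M) : (functional f).Sat s ↔
    ∀ x : M, edgeRel M f x x → ∃! y, App (edgeRel M) f x y := by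
  simp only [functional, allBlock, List.foldr, Sat, sat_edge, Function.update_self]
  refine forall₂_congr fun x hx => ?_
  have h1 : {b : M | edgeRel M f x b ∧ x = b} = {x} := by
    ext b
    simp only [Set.mem_ofPred_eq, Set.mem_singleton_iff]
    exact ⟨fun h => h.2.symm, fun h => ⟨h.symm ▸ hx, h.symm⟩⟩
  have h2 : {b : M | edgeRel M f x b} = insert x {b : M | App (edgeRel M) f x b} := by
    ext b
    simp only [Set.mem_ofPred_eq, Set.mem_insert_iff, App]
    by_cases hb : b = x
    · simp [hb, hx]
    · simp [hb, hx, Ne.symm hb]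
  have h3 : ({b : M | edgeRel M f x b}.ncard : ℚ) = {b : M | App (edgeRel M) f x b}.ncard + 1 := by
    rw [h2, Set.ncard_insert_of_notMem (by simp [App]) (Set.toFinite _)]
    push_cast
    rfl
  have h4 : ({b : M | edgeRel M f x b ∧ x = b}.ncard : ℚ) = 1 := by simp [h1]
  change ({b : M | edgeRel M f x b ∧ Function.update (Function.update s 0 x) 1 b 0 =
      Function.update (Function.update s 0 x) 1 b 1}.ncard : ℚ) =
    50 / 100 * ({b : M | edgeRel M f x b}.ncard : ℚ) ↔ _
  simp only [Function.update_self, ne_eq, zero_ne_one, not_false_eq_true, Function.update_of_ne]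
  rw [h3, h4]
  have h5 : (∃! y, App (edgeRel M) f x y) ↔ {b : M | App (edgeRel M) f x b}.ncard = 1 := by
    rw [Set.ncard_eq_one]
    constructor
    · rintro ⟨y, hy, hu⟩
      exact ⟨y, Set.ext fun b => ⟨fun h => hu b h, fun h => (Set.mem_singleton_iff.1 h) ▸ hy⟩⟩
    · rintro ⟨y, hy⟩
      have hy' : ∀ b, App (edgeRel M) f x b ↔ b = y := fun b => by
        simpa using Set.ext_iff.1 hy b
      exact ⟨y, (hy' y).2 rfl, fun b hb => (hy' b).1 hb⟩
  rw [h5]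
  constructor
  · intro h
    have : ({b : M | App (edgeRel M) f x b}.ncard : ℚ) = 1 := by linarith
    exact_mod_cast this
  · intro h
    rw [h]
    norm_num

theorem sat_stateSentence [DecidableEq K] (P : StackMachine Q K Γ) (q : Q) (s : ℕ → M) :
    (stateSentence P q).Sat s ↔ ∀ k op g, P q = some (k, op, g) →
      (∀ x, labRel M (.state q : Label Q Γ) x → edgeRel M (.step : FunSym K) x x) ∧
      (∀ o x y, App (edgeRel M) (.step : FunSym K) x y → labRel M (.state q : Label Q Γ) x →
        ∀ z, App (edgeRel M) (.top k) x z → labRel M (.sym o : Label Q Γ) z →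
          labRel M (.state (g o) : Label Q Γ) y) ∧
      ∀ k' x y, App (edgeRel M) (.step : FunSym K) x y → labRel M (.state q : Label Q Γ) x →
        OpRel (labRel M : Label Q Γ → M → Prop) (edgeRel M) (guardRel M x y) k' x y
          (if k' = k then op else .keep) := by
  unfold stateSentence
  rcases h : P q with _ | ⟨k, op, g⟩
  · simp [verum, allBlock, Sat]
  · simp only [Sat, sat_labRule, sat_edge, sat_conj, sat_rule, sat_lab, sat_opFormula,
      Option.some.injEq, Prod.mk.injEq]
    constructor
    · rintro ⟨h1, h2, h3⟩ _ _ _ ⟨rfl, rfl, rfl⟩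
      refine ⟨by simpa using h1, fun o x y hxy hx z hz ho => ?_, by simpa using h3⟩
      simpa using h2 o x y hxy ⟨by simpa using hx,
        (sat_wit _ (by simp) _ _).2 ⟨z, by simpa using hz, by simpa [sat_lab] using ho⟩⟩
    · intro h
      obtain ⟨h1, h2, h3⟩ := h k op g ⟨rfl, rfl, rfl⟩
      refine ⟨by simpa using h1, fun o x y hxy ⟨hx, hw⟩ => ?_, by simpa using h3⟩
      obtain ⟨z, hz, ho⟩ := (sat_wit _ (by simp) _ _).1 hw
      simpa using h2 o x y hxy (by simpa using hx) z (by simpa using hz)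
        (by simpa [sat_lab] using ho)

theorem sat_haltSentence [DecidableEq K] [Finite M] (P : StackMachine Q K Γ) (q₀ : Q) (k₀ : K)
    (a e : Γ) (m : ℕ) (s : ℕ → M) : (haltSentence P q₀ k₀ a e m).Sat s ↔
      IsModel P q₀ k₀ a e m (labRel M) (edgeRel M) (guardRel M) := by
  simp only [haltSentence, machineSentence, dataSentence, initSentence, inputSentence, Sat,
    sat_conj, sat_functional, sat_rule, sat_labRule, sat_stateSentence, sat_edge, sat_lab, sat_app]
  constructor
  · rintro ⟨⟨⟨h1, h2, h3, h4, h5⟩, h6, h7, h8, h9⟩, h10⟩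
    refine ⟨h1, ?_, by simpa using h3, by simpa using h4, by simpa using h5,
      fun q k op g h => (h6 q k op g h).1, fun q k op g h => (h6 q k op g h).2.1,
      fun q k op g h => (h6 q k op g h).2.2, by simpa [exBlock, Sat, sat_lab] using h7,
      by simpa using h8, ?_, ?_⟩
    · simpa [sat_meet] using h2
    · simpa [sat_wit, sat_lab] using h9
    · simpa [sat_wit, sat_chain] using h10
  · intro h
    refine ⟨⟨⟨h.functional, by simpa [sat_meet] using h.below, by simpa using h.bottom_next,
      by simpa using h.bottom_below, by simpa using h.prev⟩,
      fun q k op g hq => ⟨h.progress q k op g hq, h.state q k op g hq, h.stack q k op g hq⟩,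
      by simpa [exBlock, Sat, sat_lab] using h.exists_init, by simpa using h.init_prev, ?_⟩, ?_⟩
    · simpa [sat_wit, sat_lab] using h.init_empty
    · simpa [sat_wit, sat_chain] using h.init_input

end Semantics

end PercLogic

/-! ### From finite models to halting runs -/

namespace PercLogic

section Soundness

variable {Q K Γ M : Type}

/-- The cells below `x`, including `x`, hold the stack contents `l`. -/
def Represents (L : Label Q Γ → M → Prop) (E : FunSym K → M → M → Prop) (x : M) (l : List Γ) :
    Prop :=
  ∃ u : ℕ → M, u 0 = x ∧ ∀ i, App E .next (u i) (u (i + 1)) ∧ L (.sym l[i]?) (u i)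

/-- The element `x` represents the configuration `c`. -/
def RepresentsCfg (L : Label Q Γ → M → Prop) (E : FunSym K → M → M → Prop) (x : M)
    (c : Q × (K → List Γ)) : Prop :=
  L (.state c.1) x ∧ ∀ k, ∃ y, App E (.top k) x y ∧ Represents L E y (c.2 k)

variable {L : Label Q Γ → M → Prop} {E : FunSym K → M → M → Prop}

theorem Represents.head {x : M} {l : List Γ} (h : Represents L E x l) : L (.sym l.head?) x := by
  obtain ⟨u, rfl, hu⟩ := h
  rw [List.head?_eq_getElem?]
  exact (hu 0).2

theorem Represents.cons {x y : M} {l : List Γ} {a : Γ} (h : Represents L E y l)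
    (hxy : App E .next x y) (ha : L (.sym (some a)) x) : Represents L E x (a :: l) := by
  obtain ⟨u, rfl, hu⟩ := h
  refine ⟨fun i => Nat.casesOn i x u, rfl, fun i => ?_⟩
  cases i with
  | zero => exact ⟨hxy, ha⟩
  | succ i => exact hu i

namespace IsModel

variable [DecidableEq K] {P : StackMachine Q K Γ} {q₀ : Q} {k₀ : K} {a e : Γ} {m : ℕ}
  {G : M → M → M → Prop}

theorem app_unique (h : IsModel P q₀ k₀ a e m L E G)
    {f : FunSym K} {x y z : M} (hy : App E f x y) (hz : App E f x z) : y = z :=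
  (h.functional f x hy.1).unique hy hz

theorem represents_tail (h : IsModel P q₀ k₀ a e m L E G)
    {x y : M} {l : List Γ} (hx : Represents L E x l)
    (hxy : App E .next x y) : Represents L E y l.tail := by
  obtain ⟨u, rfl, hu⟩ := hx
  refine ⟨fun i => u (i + 1), h.app_unique (hu 0).1 hxy, fun i => ?_⟩
  rw [List.getElem?_tail]
  exact hu (i + 1)

/-- Bottom cells have bottom cells below them forever. The path may cycle in a finite model, which
is harmless since `Represents` does not ask for distinct cells. -/
theorem represents_nil (h : IsModel P q₀ k₀ a e m L E G)
    {x : M} (hx : L (.sym none) x) : Represents L E x [] := by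
  have hn : ∀ x : {x // L (.sym none) x}, ∃ y : {x // L (.sym none) x}, App E .next x.1 y.1 := by
    rintro ⟨x, hx⟩
    obtain ⟨y, hy, -⟩ := h.functional .next x (h.bottom_next x hx)
    exact ⟨⟨y, h.bottom_below x y hy hx⟩, hy⟩
  choose n hn using hn
  refine ⟨fun i => (n^[i] ⟨x, hx⟩).1, rfl, fun i => ⟨?_, ?_⟩⟩
  · simp only [Function.iterate_succ_apply']
    exact hn _
  · simpa using (n^[i] ⟨x, hx⟩).2

theorem represents_chain (h : IsModel P q₀ k₀ a e m L E G)
    {j : ℕ} {x : M} (hx : ChainRel L E a e j x) :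
    Represents L E x (List.replicate j a ++ [e]) := by
  induction j generalizing x with
  | zero =>
    obtain ⟨he, y, hxy, hy⟩ := hx
    exact (h.represents_nil hy).cons hxy he
  | succ j ih =>
    obtain ⟨ha, y, hxy, hy⟩ := hx
    rw [List.replicate_succ]
    exact (ih hy).cons hxy ha

/-- Functionality identifies the common value in `Meet` with the actual cell; for `pop` and `push`,
the `below` axiom converts the second cell of a configuration into the `next` of its top. -/
theorem exists_represents_apply (h : IsModel P q₀ k₀ a e m L E G)
    {k : K} {x y z : M} {l : List Γ} {op : StackOp Γ}
    (hz : App E (.top k) x z) (hl : Represents L E z l) (hop : OpRel L E (G x y) k x y op) :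
    ∃ z, App E (.top k) y z ∧ Represents L E z (op.apply l) := by
  cases op with
  | keep =>
    obtain ⟨w, -, hxw, hyw⟩ := hop
    obtain rfl := h.app_unique hz hxw
    exact ⟨z, hyw, hl⟩
  | pop =>
    obtain ⟨w, -, hxw, hyw⟩ := hop
    obtain ⟨v, -, hzv, hxv⟩ := h.below k x z hz
    obtain rfl := h.app_unique hxw hxv
    exact ⟨w, hyw, h.represents_tail hl hzv⟩
  | push b =>
    obtain ⟨⟨w, -, hxw, hyw⟩, t, hyt, hb⟩ := hop
    obtain rfl := h.app_unique hz hxw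
    obtain ⟨v, -, htv, hyv⟩ := h.below k y t hyt
    obtain rfl := h.app_unique hyw hyv
    exact ⟨t, hyt, hl.cons htv hb⟩

/-- Labels need not be exclusive: an element may carry extra ones, but those required by the run
propagate. -/
theorem exists_representsCfg_step (h : IsModel P q₀ k₀ a e m L E G)
    {x : M} {c d : Q × (K → List Γ)} (hx : RepresentsCfg L E x c)
    (hcd : P.step c = some d) : ∃ y, App E .step x y ∧ RepresentsCfg L E y d := by
  obtain ⟨hq, hs⟩ := hx
  obtain ⟨⟨k, op, g⟩, hP, rfl⟩ := Option.map_eq_some_iff.1 hcd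
  obtain ⟨y, hxy, -⟩ := h.functional .step x (h.progress _ _ _ _ hP x hq)
  refine ⟨y, hxy, ?_, fun k' => ?_⟩
  · obtain ⟨z, hxz, hz⟩ := hs k
    exact h.state _ _ _ _ hP _ x y hxy hq z hxz hz.head
  · obtain ⟨z, hxz, hz⟩ := hs k'
    have hop := h.stack _ _ _ _ hP k' x y hxy hq
    have := h.exists_represents_apply hxz hz hop
    by_cases hk : k' = k
    · subst hk
      simpa using this
    · simpa [hk, StackOp.apply] using this

theorem exists_representsCfg_init (h : IsModel P q₀ k₀ a e m L E G) :
    ∃ x, L .init x ∧ RepresentsCfg L E x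
    (q₀, Function.update (fun _ => []) k₀ (List.replicate m a ++ [e])) := by
  obtain ⟨x, hx, hq⟩ := h.exists_init
  refine ⟨x, hx, hq, fun k => ?_⟩
  by_cases hk : k = k₀
  · subst hk
    obtain ⟨y, hxy, hy⟩ := h.init_input x hx
    exact ⟨y, hxy, by simpa using h.represents_chain hy⟩
  · obtain ⟨y, hxy, hy⟩ := h.init_empty k hk x hx
    exact ⟨y, hxy, by simpa [hk] using h.represents_nil hy⟩

theorem halts [Finite M] (h : IsModel P q₀ k₀ a e m L E G) :
    P.Halts (q₀, Function.update (fun _ => []) k₀ (List.replicate m a ++ [e])) := by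
  obtain ⟨x₀, hinit, hx₀⟩ := h.exists_representsCfg_init
  rw [StackMachine.Halts, eval_dom_iff_iterate]
  generalize (q₀, Function.update (fun _ => []) k₀ (List.replicate m a ++ [e])) = c₀ at hx₀
  by_contra! hne
  set c : ℕ → Q × (K → List Γ) := fun n => (fun c => (P.step c).getD c)^[n] c₀
  have hc : ∀ n, P.step (c n) = some (c (n + 1)) := by
    intro n
    obtain ⟨d, hd⟩ := Option.ne_none_iff_exists'.1 (hne n)
    simp only [c, Function.iterate_succ_apply', hd, Option.getD_some]
  choose! y hstep hy using fun n x (hx : RepresentsCfg L E x (c n)) =>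
    h.exists_representsCfg_step hx (hc n)
  let x : ℕ → M := fun n => Nat.rec x₀ y n
  have hx : ∀ n, RepresentsCfg L E (x n) (c n) := by
    intro n
    induction n with
    | zero => exact hx₀
    | succ n ih => exact hy n _ ih
  have hprev : ∀ n, App E .prev (x (n + 1)) (x n) := fun n => h.prev _ _ (hstep n _ (hx n))
  -- Having a `prev` value includes having a `prev` loop, which the initial element lacks.
  have hzero : ∀ n, x (n + 1) ≠ x 0 := fun n hn =>
    h.init_prev x₀ hinit (by have := (hprev n).1; rwa [hn] at this)
  -- Equal elements have equal `prev` values, so a repetition descends to the initial element.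
  have hinj : ∀ i j, x i = x j → i = j := by
    intro i
    induction i with
    | zero =>
      rintro (_ | j) hj
      exacts [rfl, (hzero j hj.symm).elim]
    | succ i ih =>
      rintro (_ | j) hj
      · exact (hzero i hj).elim
      · have hi := hprev i
        rw [hj] at hi
        rw [ih j (h.app_unique hi (hprev j))]
  exact not_injective_infinite_finite x fun i j => hinj i j

end IsModel

end Soundness

end PercLogic

/-! ### From halting runs to finite models -/

namespace PercLogic

open FirstOrder Formula

section Completeness

variable {Q K Γ M : Type}

/-- The structure with given interpretations of the symbols in use. -/
abbrev structureOf [Finite Q] [Finite K] [Finite Γ] (L : Label Q Γ → M → Prop)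
    (E : FunSym K → M → M → Prop) (G : M → M → M → Prop) : relLang.Structure M where
  funMap f _ := Empty.elim f
  RelMap {n} r v := match n, v with
    | 1, v => ∃ l : Label Q Γ, index l = r ∧ L l (v 0)
    | 2, v => ∃ f : FunSym K, index f = r ∧ E f (v 0) (v 1)
    | 3, v => G (v 0) (v 1) (v 2)
    | _, _ => False

/-- Symbols of different arities may share a number, so it is enough that `index` is injective on
each type of symbols. -/
theorem IsModel.finSat [Finite Q] [Finite K] [Finite Γ] [DecidableEq K] [Finite M]
    {P : StackMachine Q K Γ} {q₀ : Q} {k₀ : K} {a e : Γ} {m : ℕ} {L : Label Q Γ → M → Prop}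
    {E : FunSym K → M → M → Prop} {G : M → M → M → Prop} (h : IsModel P q₀ k₀ a e m L E G) :
    (haltSentence P q₀ k₀ a e m).FinSat := by
  let := structureOf L E G
  have hL : labRel M = L := by
    funext l x
    exact propext ⟨fun ⟨l', h, hx⟩ => index_injective h ▸ hx, fun hx => ⟨l, rfl, hx⟩⟩
  have hE : edgeRel M = E := by
    funext f x y
    exact propext ⟨fun ⟨f', h, hx⟩ => index_injective h ▸ hx, fun hx => ⟨f, rfl, hx⟩⟩
  have hG : guardRel M = G := rfl
  obtain ⟨x, -⟩ := h.exists_init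
  refine ⟨M, ⟨x⟩, inferInstance, inferInstance, fun s => ?_⟩
  rw [sat_haltSentence, hL, hE, hG]
  exact h

/-- A stack cell: the contents of the stack from this cell downwards, and a bit that makes
neighbouring cells different. -/
abbrev Cell (Γ : Type) : Type := Bool × List Γ

/-- The cell below a cell. -/
def Cell.tail (z : Cell Γ) : Cell Γ := (!z.1, z.2.tail)

/-- The top cell after an operation. -/
def StackOp.applyCell : StackOp Γ → Cell Γ → Cell Γ
  | keep, z => z
  | pop, z => z.tail
  | push a, z => (!z.1, a :: z.2)

theorem StackOp.applyCell_snd (op : StackOp Γ) (z : Cell Γ) :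
    (op.applyCell z).2 = op.apply z.2 := by
  cases op <;> rfl

/-- The encoded functions must have no fixed points; below the bottom the list stays empty and only
the bit changes. -/
theorem Cell.tail_ne (z : Cell Γ) : z.tail ≠ z := fun h =>
  Bool.not_ne_self z.1 (congrArg Prod.fst h)

/-- One step of the computation on cells; halting configurations are kept. -/
def cellStep [DecidableEq K] (P : StackMachine Q K Γ) (c : Q × (K → Cell Γ)) :
    Q × (K → Cell Γ) :=
  match P c.1 with
  | none => c
  | some (k, op, g) => (g (c.2 k).2.head?, Function.update c.2 k (op.applyCell (c.2 k)))

/-- Forgetting the bits semiconjugates the run on cells to the run on stacks. -/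
theorem cellStep_iterate [DecidableEq K] (P : StackMachine Q K Γ) (n : ℕ)
    (c : Q × (K → Cell Γ)) :
    (((cellStep P)^[n] c).1, fun k => (((cellStep P)^[n] c).2 k).2) =
      (fun d => (P.step d).getD d)^[n] (c.1, fun k => (c.2 k).2) := by
  have H : Function.Semiconj (fun c : Q × (K → Cell Γ) => (c.1, fun k => (c.2 k).2))
      (cellStep P) fun d => (P.step d).getD d := by
    rintro ⟨q, s⟩
    rcases h : P q with _ | ⟨k, op, g⟩
    · simp [cellStep, StackMachine.step, h]
    · simp only [cellStep, StackMachine.step, h, Option.map_some, Option.getD_some, Prod.mk.injEq,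
        true_and]
      funext k'
      by_cases hk : k' = k
      · subst hk
        simp [StackOp.applyCell_snd]
      · simp [hk]
  exact (H.iterate_right n) c

/-- The partial functions on the times and the cells of a computation. -/
def runFun (c : ℕ → Q × (K → Cell Γ)) (T : ℕ) : FunSym K → ℕ ⊕ Cell Γ → Option (ℕ ⊕ Cell Γ)
  | .top k, .inl n => some (.inr ((c n).2 k))
  | .below k, .inl n => some (.inr ((c n).2 k).tail)
  | .next, .inr z => some (.inr z.tail)
  | .step, .inl n => if n < T then some (.inl (n + 1)) else none
  | .prev, .inl (n + 1) => some (.inl n)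
  | _, _ => none

theorem runFun_ne (c : ℕ → Q × (K → Cell Γ)) (T : ℕ) (f : FunSym K) (x : ℕ ⊕ Cell Γ) :
    runFun c T f x ≠ some x := by
  rcases f <;> rcases x with (_ | n) | z <;> simp [runFun, Cell.tail_ne]

/-- The labels of the times and the cells of a computation. -/
def runLab (c : ℕ → Q × (K → Cell Γ)) : Label Q Γ → ℕ ⊕ Cell Γ → Prop
  | .init, x => x = .inl 0
  | .state q, x => ∃ n, x = .inl n ∧ (c n).1 = q
  | .sym o, x => ∃ z, x = .inr z ∧ z.2.head? = o

/-- The times up to `T` and the cells of height up to `N`. -/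
def runSet (Γ : Type) (T N : ℕ) : Set (ℕ ⊕ Cell Γ) :=
  {x | Sum.elim (fun n => n ≤ T) (fun z => z.2.length ≤ N) x}

theorem finite_runSet [Finite Γ] (T N : ℕ) : (runSet Γ T N).Finite := by
  have h1 : (Sum.inl '' Set.Iic T : Set (ℕ ⊕ Cell Γ)).Finite := (Set.finite_Iic T).image _
  have h2 : (Sum.inr '' ((Set.univ : Set Bool) ×ˢ {l : List Γ | l.length ≤ N}) :
      Set (ℕ ⊕ Cell Γ)).Finite :=
    (Set.finite_univ.prod (List.finite_length_le Γ N)).image _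
  refine (h1.union h2).subset ?_
  rintro (n | z) h
  · exact .inl ⟨n, h, rfl⟩
  · exact .inr ⟨z, ⟨trivial, h⟩, rfl⟩

/-- The edges of the partial functions: besides the value, each argument is related to itself. -/
def runEdge (c : ℕ → Q × (K → Cell Γ)) (T : ℕ) {X : Set (ℕ ⊕ Cell Γ)} (f : FunSym K) (x y : X) :
    Prop :=
  ∃ z, runFun c T f x = some z ∧ (y.1 = x.1 ∨ y.1 = z)

theorem app_runEdge (c : ℕ → Q × (K → Cell Γ)) (T : ℕ) {X : Set (ℕ ⊕ Cell Γ)} (f : FunSym K)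
    (x y : X) : App (runEdge c T) f x y ↔ runFun c T f x = some y.1 := by
  constructor
  · rintro ⟨-, ⟨z, hz, h | rfl⟩, hne⟩
    · exact (hne (Subtype.ext h.symm)).elim
    · exact hz
  · intro h
    refine ⟨⟨_, h, .inl rfl⟩, ⟨_, h, .inr rfl⟩, ?_⟩
    rintro rfl
    exact runFun_ne _ _ _ _ h

theorem chainRel_run (c : ℕ → Q × (K → Cell Γ)) (T N : ℕ) (a e : Γ) (j : ℕ)
    (x : runSet Γ T N) (b : Bool) (hx : x.1 = .inr (b, List.replicate j a ++ [e])) :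
    ChainRel (fun l (x : runSet Γ T N) => runLab c l x.1) (runEdge c T) a e j x := by
  have hlen : (List.replicate j a ++ [e]).length ≤ N := by
    have := x.2
    rwa [hx] at this
  induction j generalizing x b with
  | zero =>
    refine ⟨⟨_, hx, rfl⟩, ⟨.inr (!b, []), Nat.zero_le _⟩, ?_, ⟨_, rfl, rfl⟩⟩
    rw [app_runEdge, hx]
    rfl
  | succ j ih =>
    have hlen' : (List.replicate j a ++ [e]).length ≤ N := by
      simp at hlen ⊢
      omega
    refine ⟨⟨_, hx, rfl⟩, ⟨.inr (!b, List.replicate j a ++ [e]), hlen'⟩, ?_,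
      ih _ (!b) rfl hlen'⟩
    rw [app_runEdge, hx]
    rfl

/-- Taking times rather than configurations as elements makes `prev` the predecessor map. Guards
cost nothing, since the ternary relation can be total. -/
theorem isModel_run [DecidableEq K] {P : StackMachine Q K Γ} {q₀ : Q} {k₀ : K} {a e : Γ}
    {m T N : ℕ} {c : ℕ → Q × (K → Cell Γ)}
    (hc₀ : c 0 = (q₀, fun k => (false, Function.update (fun _ => []) k₀
      (List.replicate m a ++ [e]) k)))
    (hc : ∀ n, c (n + 1) = cellStep P (c n)) (hT : P (c T).1 = none)
    (hN : ∀ n ≤ T, ∀ k, ((c n).2 k).2.length ≤ N) :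
    IsModel P q₀ k₀ a e m (fun l (x : runSet Γ T N) => runLab c l x.1) (runEdge c T)
      (fun _ _ _ => True) := by
  -- Truncation is safe: `step` stops at `T`, tops have height at most `N`, and tails do not grow.
  have hclosed : ∀ f, ∀ x ∈ runSet Γ T N, ∀ y, runFun c T f x = some y → y ∈ runSet Γ T N := by
    have htail : ∀ z : Cell Γ, z.2.length ≤ N → z.tail.2.length ≤ N := fun z hz => by
      simp only [Cell.tail, List.length_tail]
      omega
    rintro (k | k | _ | _ | _) ((_ | n) | z) hx y hy <;>
      simp only [runFun, Option.some.injEq, reduceCtorEq, Option.ite_none_right_eq_some] at hy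
    · exact hy ▸ hN _ hx k
    · exact hy ▸ hN _ hx k
    · exact hy ▸ htail _ (hN _ hx k)
    · exact hy ▸ htail _ (hN _ hx k)
    · exact hy ▸ htail _ hx
    · exact hy.2 ▸ hy.1
    · exact hy.2 ▸ hy.1
    · exact hy ▸ Nat.le_of_succ_le hx
  have hstep : ∀ x y : runSet Γ T N, runFun c T .step x = some y.1 →
      ∃ n, n < T ∧ x.1 = .inl n ∧ y.1 = .inl (n + 1) := by
    rintro ⟨n | z, hx⟩ y hy
    · simp only [runFun, Option.ite_none_right_eq_some, Option.some.injEq] at hy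
      exact ⟨n, hy.1, rfl, hy.2.symm⟩
    · simp [runFun] at hy
  have hcell : ∀ (n : ℕ), n ≤ T → ∀ k, Sum.inr ((c n).2 k) ∈ runSet Γ T N :=
    fun n hn k => hN n hn k
  refine ⟨?_, ?_, ?_, ?_, ?_, ?_, ?_, ?_, ?_, ?_, ?_, ?_⟩
  · rintro f x ⟨z, hz, -⟩
    refine ⟨⟨z, hclosed f x x.2 z hz⟩, (app_runEdge _ _ _ _ _).2 hz, fun y hy => ?_⟩
    replace hy := (app_runEdge _ _ _ _ _).1 hy
    rw [hz] at hy
    exact Subtype.ext (Option.some.inj hy).symm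
  · rintro k ⟨n | z, hx⟩ y hxy
    · rw [app_runEdge] at hxy
      have hy : y.1 = .inr ((c n).2 k) := (Option.some.inj hxy).symm
      refine ⟨⟨_, hclosed (.below k) _ hx _ rfl⟩, trivial, ?_, ?_⟩
      · rw [app_runEdge, hy]
        rfl
      · rw [app_runEdge]
        rfl
    · rw [app_runEdge] at hxy
      simp [runFun] at hxy
  · rintro ⟨_, hx⟩ ⟨z, rfl, -⟩
    exact ⟨_, rfl, .inl rfl⟩
  · rintro ⟨_, hx⟩ y hxy ⟨z, rfl, hz⟩
    rw [app_runEdge] at hxy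
    refine ⟨_, (Option.some.inj hxy).symm, ?_⟩
    rw [List.head?_eq_none_iff] at hz
    simp [Cell.tail, hz]
  · intro x y hxy
    rw [app_runEdge] at hxy ⊢
    obtain ⟨n, -, hx, hy⟩ := hstep x y hxy
    rw [hx, hy]
    rfl
  · rintro q k op g hP ⟨_, hx⟩ ⟨n, rfl, rfl⟩
    -- A state with an instruction cannot be the one at time `T`, the only time without `step`.
    have hn : n < T := lt_of_le_of_ne hx fun h => by simp [h, hT] at hP
    exact ⟨.inl (n + 1), by simp [runFun, hn], .inl rfl⟩
  · rintro q k op g hP o x y hxy ⟨n, hx, rfl⟩ z hz ⟨w, hw, ho⟩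
    rw [app_runEdge] at hxy hz
    obtain ⟨n', -, hx', hy⟩ := hstep x y hxy
    obtain rfl : n = n' := Sum.inl.inj (hx.symm.trans hx')
    rw [hx, hw] at hz
    obtain rfl : (c n).2 k = w := Sum.inr.inj (Option.some.inj hz)
    exact ⟨n + 1, hy, by rw [hc, cellStep, hP, ← ho]⟩
  · rintro q k op g hP k' x y hxy ⟨n, hx, rfl⟩
    rw [app_runEdge] at hxy
    obtain ⟨n', hn, hx', hy⟩ := hstep x y hxy
    obtain rfl : n = n' := Sum.inl.inj (hx.symm.trans hx')
    have hs : (c (n + 1)).2 k' = (if k' = k then op else .keep).applyCell ((c n).2 k') := by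
      rw [hc, cellStep, hP]
      by_cases hk : k' = k
      · subst hk
        simp
      · simp [hk, StackOp.applyCell]
    generalize (if k' = k then op else .keep) = op' at hs
    cases op' with
    | keep =>
      refine ⟨⟨_, hcell n hn.le k'⟩, trivial, ?_, ?_⟩
      · rw [app_runEdge, hx]
        rfl
      · rw [app_runEdge, hy]
        simp [runFun, hs, StackOp.applyCell]
    | pop =>
      refine ⟨⟨_, hcell (n + 1) hn k'⟩, trivial, ?_, ?_⟩
      · rw [app_runEdge, hx]
        simp [runFun, hs, StackOp.applyCell]
      · rw [app_runEdge, hy]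
        rfl
    | push b =>
      refine ⟨⟨⟨_, hcell n hn.le k'⟩, trivial, ?_, ?_⟩, ⟨_, hcell (n + 1) hn k'⟩, ?_, _, rfl, ?_⟩
      · rw [app_runEdge, hx]
        rfl
      · rw [app_runEdge, hy]
        -- Pushing and taking the tail flip the bit twice, which returns exactly the old cell.
        simp [runFun, hs, StackOp.applyCell, Cell.tail]
      · rw [app_runEdge, hy]
        rfl
      · rw [hs]
        rfl
  · exact ⟨⟨.inl 0, Nat.zero_le _⟩, rfl, 0, rfl, by rw [hc₀]⟩
  · rintro ⟨_, hx⟩ rfl ⟨z, hz, -⟩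
    simp [runFun] at hz
  · rintro k hk ⟨_, hx⟩ rfl
    refine ⟨⟨_, hcell 0 (Nat.zero_le _) k⟩, ?_, _, rfl, ?_⟩
    · rw [app_runEdge]
      rfl
    · simp [hc₀, hk]
  · rintro ⟨_, hx⟩ rfl
    refine ⟨⟨_, hcell 0 (Nat.zero_le _) k₀⟩, ?_, chainRel_run c T N a e m _ false ?_⟩
    · rw [app_runEdge]
      rfl
    · simp [hc₀]

theorem finSat_haltSentence_iff [Finite Q] [Finite K] [Finite Γ] [DecidableEq K]
    (P : StackMachine Q K Γ) (q₀ : Q) (k₀ : K) (a e : Γ) (m : ℕ) :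
    (haltSentence P q₀ k₀ a e m).FinSat ↔
      P.Halts (q₀, Function.update (fun _ => []) k₀ (List.replicate m a ++ [e])) := by
  constructor
  · rintro ⟨M, ⟨x⟩, _, _, h⟩
    exact ((sat_haltSentence P q₀ k₀ a e m _).1 (h fun _ => x)).halts
  · rw [StackMachine.Halts, eval_dom_iff_iterate]
    rintro ⟨T, hT⟩
    set c : ℕ → Q × (K → Cell Γ) := fun n => (cellStep P)^[n]
      (q₀, fun k => (false, Function.update (fun _ => []) k₀ (List.replicate m a ++ [e]) k))
      with hc
    have hT' : P (c T).1 = none := by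
      rw [← cellStep_iterate P T (q₀, fun k => (false, Function.update (fun _ => []) k₀
        (List.replicate m a ++ [e]) k))] at hT
      exact Option.map_eq_none_iff.1 hT
    -- `N` bounds the heights of finitely many stacks at finitely many times.
    obtain ⟨N, hN⟩ := (Set.finite_range fun p : Fin (T + 1) × K =>
      ((c p.1).2 p.2).2.length).bddAbove
    have : Finite (runSet Γ T N) := (finite_runSet T N).to_subtype
    exact (isModel_run (N := N) rfl (fun n => Function.iterate_succ_apply' _ _ _) hT'
      fun n hn k => hN ⟨(⟨n, Nat.lt_succ_of_le hn⟩, k), rfl⟩).finSat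

end Completeness

/-! ### The reduction is computable -/

section Computability

variable {Q K Γ : Type} [Finite Q] [Finite K] [Finite Γ]

theorem primrec_pair_left (c : ℕ) {f : ℕ → ℕ} (hf : Primrec f) :
    Primrec fun n => Nat.pair c (f n) :=
  Primrec₂.natPair.comp (Primrec.const c) hf

/-- Passing from `m` to `m + 1` pairs the previous code with twelve constants, so primitive
recursion applies. -/
theorem primrec_code_chain (a e : Γ) : Primrec fun m => (chain Q K a e m).code := by
  have hF : Primrec fun n =>
      Nat.pair 3 (Nat.pair (lab (.sym (some a) : Label Q Γ) 1).code
        (Nat.pair 7 (Nat.pair 0 (Nat.pair 3 (Nat.pair (edge (.next : FunSym K) 1 0).code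
          (Nat.pair 3 (Nat.pair (app (.next : FunSym K) 1 0).code
            (Nat.pair 7 (Nat.pair 1 (Nat.pair 3 (Nat.pair (Nat.pair 0 (Nat.pair 1 0))
              n))))))))))) := by
    iterate 12 refine primrec_pair_left _ ?_
    exact Primrec.id
  refine (Primrec.nat_rec₁ (chain Q K a e 0).code (hF.comp Primrec.snd).to₂).of_eq fun m => ?_
  induction m with
  | zero => rfl
  | succ m ih =>
    simp only [ih]
    simp only [chain, wit, exBlock, List.foldr, code]

/-- The noncomputable choices in `conj` and `index` do no harm: for a fixed machine they contribute
only constants. -/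
theorem primrec_code_haltSentence [DecidableEq K] (P : StackMachine Q K Γ) (q₀ : Q) (k₀ : K)
    (a e : Γ) : Primrec fun m => (haltSentence P q₀ k₀ a e m).code := by
  simp only [haltSentence, inputSentence, labRule, wit, allBlock, exBlock, List.foldr, code]
  iterate 12 refine primrec_pair_left _ ?_
  exact primrec_code_chain a e

end Computability

/-- A decision procedure would decide whether an arbitrary code halts on input 0. Allowing any `C`
that contains the ternary sentences covers both claims at once. -/
theorem not_finSatDecidable {C : Set Formula} (hC : ∀ φ, IsTernaryOn ∅ φ → φ ∈ C) :
    ¬ FinSatDecidable C := by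
  rintro ⟨f, hf, h⟩
  obtain ⟨Q, K, Γ, _, _, _, _, P, q₀, k₀, a, e, hP⟩ := exists_stackMachine_halting
  refine ComputablePred.halting_problem 0 (ComputablePred.computable_iff.2
    ⟨fun c => f (haltSentence P q₀ k₀ a e (Encodable.encode c)).code,
      hf.comp ((primrec_code_haltSentence P q₀ k₀ a e).to_comp.comp Computable.encode), ?_⟩)
  funext c
  refine propext ?_
  rw [h _ (hC _ (.haltSentence P q₀ k₀ a e _)), finSat_haltSentence_iff, hP,
    Denumerable.ofNat_encode]

end PercLogic

theorem mainTheorem4 :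
    ¬ PercLogic.FinSatDecidable PercLogic.GFLocSentences ∧
    ¬ PercLogic.FinSatDecidable
      {φ | φ ∈ PercLogic.GFLocVarSentences 3 ∧ φ.ArityLE 3} := by
  refine ⟨PercLogic.not_finSatDecidable fun φ h => ?_, PercLogic.not_finSatDecidable fun φ h => ?_⟩
  · exact ⟨h.gfLoc, Finset.subset_empty.1 h.free_sub⟩
  · exact ⟨⟨⟨h.gfLoc, Finset.subset_empty.1 h.free_sub⟩, h.vars_lt⟩, h.arityLE⟩
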